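/- Let $\mathbb{E}_1,\mathbb{E}_2$ be finite-dimensional real inner product spaces. Let $f:\mathbb{E}_1\to\mathbb{R}\cup\{+\infty\}$ be convex and proper, i.e. its domain $\mathrm{dom}\, f=\{x: f(x)<+\infty\}$ is nonempty (lower semicontinuity is not assumed). Let $K\subset\mathbb{E}_2$ be a nonempty closed convex cone with polar cone $K^\circ=\{v\in\mathbb{E}_2:\langle v,x\rangle\le 0\ \text{for all } x\in K\}$, and let $F:\mathbb{E}_1\to\mathbb{E}_2$ be $K$-convex, i.e. the set $\{(x,v)\in\mathbb{E}_1\times\mathbb{E}_2: v-F(x)\in K\}$ is convex. Let $\delta_{-K}$ be the indicator function of $-K$ (equal to $0$ on $-K$ and $+\infty$ elsewhere), and for $h:\mathbb{E}_1\to\mathbb{R}\cup\{+\infty\}$ let $h^*(y)=\sup_{x\in\mathbb{E}_1}\{\langle y,x\rangle-h(x)\}$ be its Fenchel conjugate. Suppose that the Slater condition $$F\big(\mathrm{ri}(\mathrm{dom}\, f)\big)\cap \mathrm{ri}(-K)\neq\emptyset$$ holds, where $\mathrm{ri}$ denotes the relative interior. Then $$\inf_{x\in\mathbb{E}_1}\big\{f(x)+(\delta_{-K}\circ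 F)(x)\big\}=\max_{y\in\mathbb{E}_1}\big\{-f^*(y)-(\delta_{-K}\circ F)^*(-y)\big\}=\max_{v\in -K^\circ}\ \inf_{x\in\mathbb{E}_1}\big\{f(x)+\langle v,F(x)\rangle\big\}$$ as an identity in $[-\infty,+\infty]$, and both maxima are attained (if the common value is $-\infty$, this means that the respective dual objective is identically $-\infty$). -/

import Mathlib

open scoped Pointwise

noncomputable section

namespace ConicDuality

section OneSpace

variable {E : Type*} [NormedAddCommGroup E] [InnerProductSpace ℝ E]

/-- The domain of an extended real-valued function. -/
def dom (f : E → EReal) : Set E := {x | f x < ⊤}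

/-- The epigraph of `f`, a subset of `E × ℝ`. -/
def epi (f : E → EReal) : Set (E × ℝ) := {p | f p.1 ≤ (p.2 : EReal)}

/-- The class of proper convex functions `E → ℝ ∪ {+∞}`. -/
structure IsProperConvex (f : E → EReal) : Prop where
  ne_bot : ∀ x, f x ≠ ⊥
  dom_nonempty : (dom f).Nonempty
  convex_epi : Convex ℝ (epi f)

/-- The Fenchel conjugate `f*(y) = sup_x (⟪y, x⟫ - f x)`. -/
def conj (f : E → EReal) (y : E) : EReal :=
  ⨆ x : E, ((inner ℝ y x : ℝ) : EReal) - f x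

open Classical in
/-- The convex-analytic indicator function of `S`: `0` on `S` and `+∞` elsewhere. -/
def delta (S : Set E) (x : E) : EReal := if x ∈ S then 0 else ⊤

/-- The polar cone `{v | ⟪v, x⟫ ≤ 0 for all x ∈ K}`. -/
def polar (K : Set E) : Set E := {v | ∀ x ∈ K, (inner ℝ v x : ℝ) ≤ 0}

end OneSpace

section TwoSpaces

variable {E₁ E₂ : Type*} [NormedAddCommGroup E₁] [InnerProductSpace ℝ E₁]
  [NormedAddCommGroup E₂] [InnerProductSpace ℝ E₂]

/-- The `K`-epigraph `{(x, v) | F x ≤_K v}`, where `a ≤_K b` means `b - a ∈ K`. -/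
def kEpi (K : Set E₂) (F : E₁ → E₂) : Set (E₁ × E₂) := {p | p.2 - F p.1 ∈ K}

/-- `F` is `K`-convex if its `K`-epigraph is convex. -/
def KConvex (K : Set E₂) (F : E₁ → E₂) : Prop := Convex ℝ (kEpi K F)

end TwoSpaces

end ConicDuality

end

open scoped Topology

/-! Weak duality holds pointwise. For the converse, each dual problem has a convex set of pairs
(perturbation, upper bound for the perturbed value), whose fibre over 0 lies above the primal value
`p`. Slater's condition makes every perturbation extendable backwards through 0, so a nonvertical
hyperplane through `(0, p)` supports the set; its slope is the dual solution. Lagrange perturbs the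
constraint value, Fenchel the argument of `F`. Slater's point excludes `+∞`, and weak duality alone
settles `-∞`. -/

theorem exists_linear_support {E : Type*} [AddCommGroup E] [Module ℝ E]
    {A : Set (E × ℝ)} (hA : Convex ℝ A) (hne : A.Nonempty) {p : ℝ}
    (hp : ∀ r, ((0 : E), r) ∈ A → p ≤ r)
    (hcone : ∀ q ∈ A, ∃ ε > (0 : ℝ), ∃ r, (-(ε • q.1), r) ∈ A) :
    ∃ l : E →ₗ[ℝ] ℝ, ∀ q ∈ A, p ≤ q.2 + l q.1 := by
  -- By `hcone` the cone over the projection of `A` is closed under negation, hence is its whole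
  -- span.
  have hspan : ∀ u ∈ Submodule.span ℝ (Prod.fst '' A),
      ∃ c > (0 : ℝ), ∃ q ∈ A, u = c • q.1 := by
    have hzero : ∃ c > (0 : ℝ), ∃ q ∈ A, (0 : E) = c • q.1 := by
      obtain ⟨q, hq⟩ := hne
      obtain ⟨ε, hε, r, hr⟩ := hcone q hq
      refine ⟨1, one_pos, _, hA hq hr (a := ε / (1 + ε)) (b := 1 / (1 + ε)) (by positivity)
        (by positivity) (by field_simp; ring), ?_⟩
      simp only [Prod.fst_add, Prod.smul_fst]
      match_scalars
      field_simp
      ring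
    intro u hu
    induction hu using Submodule.span_induction with
    | mem x hx =>
      obtain ⟨q, hq, rfl⟩ := hx
      exact ⟨1, one_pos, q, hq, (one_smul _ _).symm⟩
    | zero => exact hzero
    | add x y _ _ hx hy =>
      obtain ⟨c, hc, q, hq, rfl⟩ := hx
      obtain ⟨d, hd, q', hq', rfl⟩ := hy
      refine ⟨c + d, by positivity, _, hA hq hq' (a := c / (c + d)) (b := d / (c + d))
        (by positivity) (by positivity) (by field_simp), ?_⟩
      simp only [Prod.fst_add, Prod.smul_fst]
      match_scalars <;> field_simp
    | smul a x _ hx =>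
      obtain ⟨c, hc, q, hq, rfl⟩ := hx
      rcases lt_trichotomy a 0 with ha | rfl | ha
      · obtain ⟨ε, hε, r, hr⟩ := hcone q hq
        refine ⟨-a * c / ε, by have := neg_pos.2 ha; positivity, _, hr, ?_⟩
        match_scalars
        field_simp
      · simpa using hzero
      · exact ⟨a * c, by positivity, q, hq, by rw [mul_smul]⟩
  obtain ⟨M, hM⟩ := Submodule.exists_isCompl (Submodule.span ℝ (Prod.fst '' A))
  -- `A` lowered by `p` and thickened by `M`: the cone over `B` plus the vertical axis then fills `E
  -- × ℝ`, as `riesz_extension` requires of the height functional.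
  let B : Set (E × ℝ) := {q | ∃ w ∈ M, (q.1 - w, q.2 + p) ∈ A}
  have hB : Convex ℝ B := by
    rintro ⟨u, r⟩ ⟨w, hw, hq⟩ ⟨u', r'⟩ ⟨w', hw', hq'⟩ a b ha hb hab
    refine ⟨a • w + b • w', M.add_mem (M.smul_mem _ hw) (M.smul_mem _ hw'), ?_⟩
    convert hA hq hq' ha hb hab using 1
    ext
    · simp only [Prod.fst_add, Prod.smul_fst]
      module
    · simp only [Prod.snd_add, Prod.smul_snd, smul_eq_mul]
      linear_combination (-p) * hab
  let φ : E × ℝ →ₗ.[ℝ] ℝ :=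
    ⟨LinearMap.ker (LinearMap.fst ℝ E ℝ), (LinearMap.snd ℝ E ℝ).domRestrict _⟩
  let S : ConvexCone ℝ (E × ℝ) :=
    { carrier := {q | q = 0 ∨ q ∈ ConvexCone.hull ℝ B}
      smul_mem' := by
        rintro c hc q (rfl | hq)
        · exact .inl (smul_zero c)
        · exact .inr (ConvexCone.smul_mem _ hc hq)
      add_mem' := by
        rintro q (rfl | hq) q' (rfl | hq')
        · exact .inl (add_zero 0)
        · exact .inr (by rwa [zero_add])
        · exact .inr (by rwa [add_zero])
        · exact .inr (ConvexCone.add_mem _ hq hq') }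
  have hS : ∀ c > (0 : ℝ), ∀ q ∈ B, c • q ∈ S := fun c hc q hq =>
    .inr (ConvexCone.smul_mem _ hc (ConvexCone.subset_hull hq))
  have hS₀ : S.Pointed := .inl rfl
  obtain ⟨g, hgφ, hgB⟩ := riesz_extension (S.toPointedCone hS₀) φ
    (by
      rintro ⟨⟨u, t⟩, hu⟩ ht
      obtain rfl : u = 0 := hu
      rcases ht with ht | ht
      · exact (congrArg Prod.snd ht).ge
      obtain ⟨c, hc, ⟨u, r⟩, ⟨w, hw, hq⟩, hcq⟩ := (ConvexCone.mem_hull_of_convex hB).1 ht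
      simp only [Prod.smul_mk, Prod.mk.injEq, smul_eq_zero, hc.ne', false_or] at hcq
      obtain ⟨rfl, rfl⟩ := hcq
      have hw0 : -w = 0 := Submodule.disjoint_def.1 hM.disjoint _
        (Submodule.subset_span ⟨_, hq, by simp⟩) (M.neg_mem hw)
      have := hp (r + p) (by simpa [neg_eq_zero.1 hw0] using hq)
      exact mul_nonneg hc.le (by linarith))
    (by
      rintro ⟨u, t⟩
      obtain ⟨l, hl, m, hm, rfl⟩ := Submodule.mem_sup.1
        (hM.sup_eq_top ▸ Submodule.mem_top : u ∈ Submodule.span ℝ (Prod.fst '' A) ⊔ M)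
      obtain ⟨c, hc, ⟨d, r⟩, hq, rfl⟩ := hspan l hl
      refine ⟨⟨(0, c * (r - p) - t), rfl⟩, ?_⟩
      have := hS c hc (d + c⁻¹ • m, r - p) ⟨c⁻¹ • m, M.smul_mem _ hm, by simpa using hq⟩
      change _ ∈ S
      simpa [smul_smul, hc.ne'] using this)
  refine ⟨g ∘ₗ LinearMap.inl ℝ E ℝ, fun q hq => ?_⟩
  have h1 : 0 ≤ g (q.1, q.2 - p) := by
    have := hS 1 one_pos (q.1, q.2 - p) ⟨0, M.zero_mem, by simpa using hq⟩
    rw [one_smul] at this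
    exact hgB _ this
  have h2 : g (0, q.2 - p) = q.2 - p := hgφ ⟨(0, q.2 - p), rfl⟩
  have h3 : g (q.1, q.2 - p) = g (q.1, 0) + g (0, q.2 - p) := by simp [← map_add]
  simp only [LinearMap.comp_apply, LinearMap.inl_apply]
  linarith

theorem exists_inner_support {E : Type*} [NormedAddCommGroup E] [InnerProductSpace ℝ E]
    [FiniteDimensional ℝ E] {A : Set (E × ℝ)} (hA : Convex ℝ A) (hne : A.Nonempty) {p : ℝ}
    (hp : ∀ r, ((0 : E), r) ∈ A → p ≤ r)
    (hcone : ∀ q ∈ A, ∃ ε > (0 : ℝ), ∃ r, (-(ε • q.1), r) ∈ A) :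
    ∃ v : E, ∀ q ∈ A, p ≤ q.2 + inner ℝ v q.1 := by
  obtain ⟨l, hl⟩ := exists_linear_support hA hne hp hcone
  refine ⟨(InnerProductSpace.toDual ℝ E).symm l.toContinuousLinearMap, fun q hq => ?_⟩
  simpa using hl q hq

/-! ### Consequences of the Slater condition -/

theorem eventually_prolong_mem_of_mem_intrinsicInterior {E : Type*} [NormedAddCommGroup E]
    [NormedSpace ℝ E] {C : Set E} {a y : E} (ha : a ∈ intrinsicInterior ℝ C) (hy : y ∈ C) :
    ∀ᶠ ε in 𝓝[>] (0 : ℝ), a - ε • (y - a) ∈ C := by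
  obtain ⟨a, ha, rfl⟩ := ha
  have hmem : ∀ ε : ℝ, (a : E) - ε • (y - a) ∈ affineSpan ℝ C := fun ε => by
    have := AffineMap.lineMap_mem (-ε) a.2 (subset_affineSpan ℝ C hy)
    rwa [AffineMap.lineMap_apply, vsub_eq_sub, vadd_eq_add, neg_smul, add_comm,
      ← sub_eq_add_neg] at this
  let γ : ℝ → affineSpan ℝ C := fun ε => ⟨(a : E) - ε • (y - a), hmem ε⟩
  have hγ : Continuous γ := by
    apply Continuous.subtype_mk
    fun_prop
  have h0 : γ 0 = a := by ext; simp [γ]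
  have hmem_nhds : Subtype.val ⁻¹' C ∈ 𝓝 (γ 0) := by
    rw [h0]
    exact mem_interior_iff_mem_nhds.1 ha
  exact nhdsWithin_le_nhds (hγ.continuousAt hmem_nhds)

namespace ConicDuality

theorem mem_dom_of_le_coe {E : Type*} {f : E → EReal} {x : E} {r : ℝ} (h : f x ≤ r) : x ∈ dom f :=
  lt_of_le_of_lt h (EReal.coe_lt_top r)

theorem delta_ne_bot {E : Type*} (S : Set E) (u : E) : delta S u ≠ ⊥ := by
  unfold delta
  split_ifs <;> simp

section

variable {E₁ E₂ : Type*} [NormedAddCommGroup E₁] [InnerProductSpace ℝ E₁]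
  [NormedAddCommGroup E₂] [InnerProductSpace ℝ E₂]

theorem KConvex.combo_mem {K : ProperCone ℝ E₂} {F : E₁ → E₂} (hF : KConvex (K : Set E₂) F)
    (x y : E₁) {a b : ℝ} (ha : 0 ≤ a) (hb : 0 ≤ b) (hab : a + b = 1) :
    a • F x + b • F y - F (a • x + b • y) ∈ K :=
  hF (x := (x, F x)) (by simp [kEpi]) (y := (y, F y)) (by simp [kEpi]) ha hb hab

/-- `F` is bounded along the segment from `x₀` to the reflection of `x` in `x₀`. The error is
absorbed by prolonging `F x₀` inside `-K`, away from a point chosen to cancel the value of `F` at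
the reflection. -/
theorem KConvex.eventually_prolong {K : ProperCone ℝ E₂} {F : E₁ → E₂}
    (hF : KConvex (K : Set E₂) F) {x₀ : E₁}
    (hx₀ : F x₀ ∈ intrinsicInterior ℝ (-(K : Set E₂))) (x : E₁) {k : E₂} (hk : k ∈ K) :
    ∀ᶠ ε in 𝓝[>] (0 : ℝ), -(ε • (F x + k)) - F (x₀ - ε • (x - x₀)) ∈ K := by
  have hmid := hF.combo_mem x (x₀ - (x - x₀)) (a := 1 / 2) (b := 1 / 2)
    (by norm_num) (by norm_num) (by norm_num)
  rw [show (1 / 2 : ℝ) • x + (1 / 2 : ℝ) • (x₀ - (x - x₀)) = x₀ by module] at hmid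
  have hκ := K.add_mem (K.smul_mem hmid (zero_le_two (α := ℝ))) hk
  have hpro := eventually_prolong_mem_of_mem_intrinsicInterior hx₀
    (Set.neg_mem_neg.2 (SetLike.mem_coe.2 hκ))
  filter_upwards [hpro, self_mem_nhdsWithin,
    nhdsWithin_le_nhds (Iio_mem_nhds (zero_lt_one (α := ℝ)))] with ε hε h0 h1
  have hcomb := hF.combo_mem x₀ (x₀ - (x - x₀)) (a := 1 - ε) (b := ε)
    (sub_nonneg.2 (le_of_lt h1)) (le_of_lt h0) (by ring)
  rw [show (1 - ε) • x₀ + ε • (x₀ - (x - x₀)) = x₀ - ε • (x - x₀) by module] at hcomb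
  have := K.add_mem hcomb (Set.mem_neg.1 hε)
  rwa [show (1 - ε) • F x₀ + ε • F (x₀ - (x - x₀)) - F (x₀ - ε • (x - x₀)) +
      -(F x₀ - ε • (-((2 : ℝ) • ((1 / 2 : ℝ) • F x + (1 / 2 : ℝ) • F (x₀ - (x - x₀)) - F x₀) + k)
        - F x₀)) = -(ε • (F x + k)) - F (x₀ - ε • (x - x₀)) by module] at this

theorem IsProperConvex.combo_le {f : E₁ → EReal} (hf : IsProperConvex f) {x y : E₁} {r s : ℝ}
    (hx : f x ≤ r) (hy : f y ≤ s) {a b : ℝ} (ha : 0 ≤ a) (hb : 0 ≤ b) (hab : a + b = 1) :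
    f (a • x + b • y) ≤ ((a * r + b * s : ℝ) : EReal) :=
  hf.convex_epi (x := (x, r)) hx (y := (y, s)) hy ha hb hab

theorem IsProperConvex.exists_coe {f : E₁ → EReal} (hf : IsProperConvex f) {x : E₁}
    (hx : x ∈ dom f) : ∃ r : ℝ, f x = r :=
  ⟨(f x).toReal, (EReal.coe_toReal (ne_of_lt hx) (hf.ne_bot x)).symm⟩

/-! ### Dual solutions and weak duality -/

/-- Existence of a Lagrange multiplier under the Slater condition. -/
theorem exists_lagrange_multiplier [FiniteDimensional ℝ E₂]
    {f : E₁ → EReal} (hf : IsProperConvex f)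
    {K : ProperCone ℝ E₂} {F : E₁ → E₂} (hF : KConvex (K : Set E₂) F) {x₀ : E₁}
    (hx₀ : x₀ ∈ intrinsicInterior ℝ (dom f))
    (hFx₀ : F x₀ ∈ intrinsicInterior ℝ (-(K : Set E₂))) {p : ℝ}
    (hp : ∀ x, -F x ∈ K → (p : EReal) ≤ f x) :
    ∃ v : E₂, (∀ k ∈ K, 0 ≤ inner ℝ v k) ∧
      ∀ x (r : ℝ), f x ≤ r → p ≤ r + inner ℝ v (F x) := by
  obtain ⟨r₀, hr₀⟩ := hf.exists_coe (intrinsicInterior_subset hx₀)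
  let A : Set (E₂ × ℝ) := {q | ∃ x, q.1 - F x ∈ K ∧ f x ≤ (q.2 : EReal)}
  have hA : Convex ℝ A := by
    rintro q ⟨x, hx, hfx⟩ q' ⟨x', hx', hfx'⟩ a b ha hb hab
    exact ⟨a • x + b • x', hF (x := (x, q.1)) hx (y := (x', q'.1)) hx' ha hb hab,
      hf.combo_le hfx hfx' ha hb hab⟩
  obtain ⟨v, hv⟩ := exists_inner_support hA (p := p) ⟨(F x₀, r₀), x₀, by simp, hr₀.le⟩
    (by
      rintro r ⟨x, hx, hfx⟩
      exact EReal.coe_le_coe_iff.1 ((hp x (by simpa using hx)).trans hfx))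
    (by
      rintro q ⟨x, hx, hfx⟩
      obtain ⟨ε, h1, h2, h3⟩ := ((hF.eventually_prolong hFx₀ x hx).and
        ((eventually_prolong_mem_of_mem_intrinsicInterior hx₀ (mem_dom_of_le_coe hfx)).and
          self_mem_nhdsWithin)).exists
      obtain ⟨r, hr⟩ := hf.exists_coe h2
      exact ⟨ε, h3, r, _, by simpa using h1, hr.le⟩)
  refine ⟨v, fun k hk => ?_, fun x r hr => hv (F x, r) ⟨x, by simp, hr⟩⟩
  by_contra! hneg
  have hc : ∀ c : ℝ, 0 ≤ c → p ≤ r₀ + (inner ℝ v (F x₀) + c * inner ℝ v k) := fun c hc => by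
    have := hv (F x₀ + c • k, r₀)
      ⟨x₀, by simpa using K.smul_mem hk hc, hr₀.le⟩
    rwa [inner_add_right, inner_smul_right] at this
  have h0 := hc 0 le_rfl
  -- This `c` turns the bound into `p ≤ p - 1`.
  have h1 := hc ((r₀ + inner ℝ v (F x₀) - p + 1) / -inner ℝ v k)
    (div_nonneg (by linarith) (by linarith))
  rw [div_neg, neg_mul, div_mul_cancel₀ _ hneg.ne] at h1
  linarith

/-- Existence of a Fenchel dual solution under the Slater condition. -/
theorem exists_fenchel_multiplier [FiniteDimensional ℝ E₁]
    {f : E₁ → EReal} (hf : IsProperConvex f)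
    {K : ProperCone ℝ E₂} {F : E₁ → E₂} (hF : KConvex (K : Set E₂) F) {x₀ : E₁}
    (hx₀ : x₀ ∈ intrinsicInterior ℝ (dom f))
    (hFx₀ : F x₀ ∈ intrinsicInterior ℝ (-(K : Set E₂))) {p : ℝ}
    (hp : ∀ x, -F x ∈ K → (p : EReal) ≤ f x) :
    ∃ y : E₁, ∀ x (r : ℝ), f x ≤ r → ∀ x', -F x' ∈ K → p ≤ r + inner ℝ y (x' - x) := by
  obtain ⟨r₀, hr₀⟩ := hf.exists_coe (intrinsicInterior_subset hx₀)
  let A : Set (E₁ × ℝ) := {q | ∃ x, -F (x + q.1) ∈ K ∧ f x ≤ (q.2 : EReal)}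
  have hA : Convex ℝ A := by
    rintro q ⟨x, hx, hfx⟩ q' ⟨x', hx', hfx'⟩ a b ha hb hab
    refine ⟨a • x + b • x', ?_, hf.combo_le hfx hfx' ha hb hab⟩
    have := hF (x := (x + q.1, 0)) (by simpa [kEpi] using hx) (y := (x' + q'.1, 0))
      (by simpa [kEpi] using hx') ha hb hab
    convert (show _ - _ ∈ K from this) using 1
    simp only [Prod.fst_add, Prod.smul_fst, Prod.snd_add, Prod.smul_snd, smul_zero, add_zero,
      zero_sub]
    congr 2
    module
  obtain ⟨y, hy⟩ := exists_inner_support hA (p := p)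
    ⟨(0, r₀), x₀, by simpa using intrinsicInterior_subset hFx₀, hr₀.le⟩
    (by
      rintro r ⟨x, hx, hfx⟩
      exact EReal.coe_le_coe_iff.1 ((hp x (by simpa using hx)).trans hfx))
    (by
      rintro q ⟨x, hx, hfx⟩
      -- With `k = -F (x + q.1)` the term `F (x + q.1) + k` vanishes, leaving plain feasibility.
      obtain ⟨ε, h1, h2, h3⟩ := ((hF.eventually_prolong hFx₀ (x + q.1) hx).and
        ((eventually_prolong_mem_of_mem_intrinsicInterior hx₀ (mem_dom_of_le_coe hfx)).and
          self_mem_nhdsWithin)).exists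
      obtain ⟨r, hr⟩ := hf.exists_coe h2
      refine ⟨ε, h3, r, _, ?_, hr.le⟩
      convert h1 using 1
      rw [add_neg_cancel, smul_zero, neg_zero, zero_sub]
      congr 2
      module)
  exact ⟨y, fun x r hr x' hx' => hy (x' - x, r) ⟨x, by simpa using hx', hr⟩⟩

theorem neg_conj_sub_conj_le {f g : E₁ → EReal} (hf : ∀ x, f x ≠ ⊥) (hg : ∀ x, g x ≠ ⊥)
    (y x : E₁) : -conj f y - conj g (-y) ≤ f x + g x := by
  have h1 : ((inner ℝ y x : ℝ) : EReal) - f x ≤ conj f y :=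
    le_iSup (fun x : E₁ => ((inner ℝ y x : ℝ) : EReal) - f x) x
  have h2 : ((inner ℝ (-y) x : ℝ) : EReal) - g x ≤ conj g (-y) :=
    le_iSup (fun x : E₁ => ((inner ℝ (-y) x : ℝ) : EReal) - g x) x
  rw [inner_neg_left] at h2
  refine (EReal.sub_le_sub (EReal.neg_le_neg_iff.2 h1) h2).trans ?_
  have hfx := hf x
  have hgx := hg x
  generalize f x = u, g x = w at hfx hgx ⊢
  induction u with
  | bot => exact (hfx rfl).elim
  | top => rw [EReal.top_add_of_ne_bot hgx]; exact le_top
  | coe a =>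
    induction w with
    | bot => exact (hgx rfl).elim
    | top => simp
    | coe b =>
      norm_cast
      linarith

end

end ConicDuality

theorem mainTheorem6
    {E₁ E₂ : Type*}
    [NormedAddCommGroup E₁] [InnerProductSpace ℝ E₁] [FiniteDimensional ℝ E₁]
    [NormedAddCommGroup E₂] [InnerProductSpace ℝ E₂] [FiniteDimensional ℝ E₂]
    (f : E₁ → EReal) (hf : ConicDuality.IsProperConvex f)
    (K : ProperCone ℝ E₂)
    (F : E₁ → E₂) (hF : ConicDuality.KConvex (K : Set E₂) F)
    (slater : ((F '' intrinsicInterior ℝ (ConicDuality.dom f)) ∩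
      intrinsicInterior ℝ (-(K : Set E₂))).Nonempty) :
    -- the maximum of the Fenchel dual exists and equals the primal optimal value
    IsGreatest
      (Set.range fun y : E₁ =>
        -ConicDuality.conj f y
          - ConicDuality.conj (ConicDuality.delta (-(K : Set E₂)) ∘ F) (-y))
      (⨅ x : E₁, f x + (ConicDuality.delta (-(K : Set E₂)) ∘ F) x) ∧
    -- the maximum of the Lagrangian dual exists and equals the primal optimal value
    IsGreatest
      ((fun v : E₂ => ⨅ x : E₁, f x + ((inner ℝ v (F x) : ℝ) : EReal)) ''
        (-ConicDuality.polar (K : Set E₂)))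
      (⨅ x : E₁, f x + (ConicDuality.delta (-(K : Set E₂)) ∘ F) x) := by
  open ConicDuality in
  obtain ⟨_, ⟨x₀, hx₀, rfl⟩, hFx₀⟩ := slater
  have hdelta : ∀ x, -F x ∈ K → (delta (-(K : Set E₂)) ∘ F) x = 0 := fun x hx => by
    simp [delta, hx]
  have hdelta' : ∀ x, -F x ∉ K → (delta (-(K : Set E₂)) ∘ F) x = ⊤ := fun x hx => by
    simp [delta, hx]
  have hx₀K : -F x₀ ∈ K := by simpa using intrinsicInterior_subset hFx₀
  have weakF : ∀ y : E₁, -conj f y - conj (delta (-(K : Set E₂)) ∘ F) (-y) ≤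
      ⨅ x : E₁, f x + (delta (-(K : Set E₂)) ∘ F) x := fun y =>
    le_iInf fun x => neg_conj_sub_conj_le hf.ne_bot (fun _ => delta_ne_bot _ _) y x
  have weakL : ∀ v : E₂, (∀ k ∈ K, 0 ≤ inner ℝ v k) →
      ⨅ x : E₁, f x + ((inner ℝ v (F x) : ℝ) : EReal) ≤
        ⨅ x : E₁, f x + (delta (-(K : Set E₂)) ∘ F) x := fun v hv => by
    refine iInf_mono fun x => ?_
    by_cases hx : -F x ∈ K
    · have := hv _ hx
      rw [inner_neg_right, neg_nonneg] at this
      rw [hdelta x hx]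
      gcongr
      exact_mod_cast this
    · rw [hdelta' x hx, EReal.add_top_of_ne_bot (hf.ne_bot x)]
      exact le_top
  have hpolar : ∀ v : E₂, v ∈ -polar (K : Set E₂) ↔ ∀ k ∈ K, 0 ≤ inner ℝ v k := fun v => by
    simp [polar]
  suffices h : (∃ y : E₁, ⨅ x : E₁, f x + (delta (-(K : Set E₂)) ∘ F) x ≤
      -conj f y - conj (delta (-(K : Set E₂)) ∘ F) (-y)) ∧
      ∃ v : E₂, (∀ k ∈ K, 0 ≤ inner ℝ v k) ∧ ⨅ x : E₁, f x + (delta (-(K : Set E₂)) ∘ F) x ≤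
        ⨅ x : E₁, f x + ((inner ℝ v (F x) : ℝ) : EReal) by
    obtain ⟨⟨y, hy⟩, v, hv, hv'⟩ := h
    refine ⟨⟨⟨y, (weakF y).antisymm hy⟩, ?_⟩,
      ⟨v, (hpolar v).2 hv, (weakL v hv).antisymm hv'⟩, ?_⟩
    · rintro _ ⟨y, rfl⟩
      exact weakF y
    · rintro _ ⟨v, hv, rfl⟩
      exact weakL v ((hpolar v).1 hv)
  obtain ⟨r₀, hr₀⟩ := hf.exists_coe (intrinsicInterior_subset hx₀)
  have hle : ∀ x, -F x ∈ K → ⨅ x : E₁, f x + (delta (-(K : Set E₂)) ∘ F) x ≤ f x :=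
    fun x hx => (iInf_le _ x).trans_eq (by rw [hdelta x hx, add_zero])
  have hfin := (hle x₀ hx₀K).trans hr₀.le
  generalize (⨅ x : E₁, f x + (delta (-(K : Set E₂)) ∘ F) x) = P at hle hfin ⊢
  induction P with
  | bot => exact ⟨⟨0, bot_le⟩, 0, by simp, bot_le⟩
  | top => exact absurd hfin (by simp)
  | coe p =>
    constructor
    · obtain ⟨y, hy⟩ := exists_fenchel_multiplier hf hF hx₀ hFx₀ hle
      refine ⟨y, ?_⟩
      -- The supremum over `x` is taken first; once `conj f y` is known to be finite, the same bound
      -- read over `x'` controls the second conjugate.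
      have hub : ∀ x', -F x' ∈ K → conj f y ≤ ((inner ℝ y x' - p : ℝ) : EReal) :=
        fun x' hx' => iSup_le fun x => by
          by_cases hx : x ∈ dom f
          · obtain ⟨r, hr⟩ := hf.exists_coe hx
            have := hy x r hr.le x' hx'
            rw [inner_sub_right] at this
            rw [hr]
            norm_cast
            linarith
          · rw [show f x = ⊤ from not_lt_top_iff.1 hx]
            simp
      have hlb : ((inner ℝ y x₀ - r₀ : ℝ) : EReal) ≤ conj f y := by
        have := le_iSup (fun x : E₁ => ((inner ℝ y x : ℝ) : EReal) - f x) x₀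
        rwa [hr₀] at this
      have hub₀ := hub x₀ hx₀K
      generalize conj f y = c at hub hlb hub₀ ⊢
      induction c with
      | bot => exact absurd hlb (EReal.bot_lt_coe _).not_ge
      | top => exact absurd hub₀ (EReal.coe_lt_top _).not_ge
      | coe c =>
        have : conj (delta (-(K : Set E₂)) ∘ F) (-y) ≤ ((-p - c : ℝ) : EReal) :=
          iSup_le fun x => by
            by_cases hx : -F x ∈ K
            · have := EReal.coe_le_coe_iff.1 (hub x hx)
              rw [hdelta x hx, sub_zero, inner_neg_left]
              norm_cast
              linarith
            · rw [hdelta' x hx]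
              simp
        refine le_trans ?_ (EReal.sub_le_sub le_rfl this)
        norm_cast
        linarith
    · obtain ⟨v, hv, hv'⟩ := exists_lagrange_multiplier hf hF hx₀ hFx₀ hle
      refine ⟨v, hv, le_iInf fun x => ?_⟩
      by_cases hx : x ∈ dom f
      · obtain ⟨r, hr⟩ := hf.exists_coe hx
        rw [hr]
        exact_mod_cast hv' x r hr.le
      · rw [show f x = ⊤ from not_lt_top_iff.1 hx]
        simp
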